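/- Let $m,q\ge 2$ be integers and let $\Sigma_m=\{0,\dots,m-1\}^{\mathbb N}$ be the space of sequences $x=(x_k)_{k\ge 1}$, with the metric $\varrho(x,y)=m^{-\min\{n\ge 1:\,x_n\ne y_n\}+1}$ for $x\neq y$. For a finite word $u$ write $[u]\subset\Sigma_m$ for the cylinder of all sequences that start with $u$, and $|u|$ for the length of $u$. Let $\Omega\subset\Sigma_m$ be closed, let $\mu$ be a Borel probability measure on $\Sigma_m$ with $\mu(\Omega)=1$, and put $$X_\Omega=\{x\in\Sigma_m:\ (x_{iq^\ell})_{\ell\ge 0}\in\Omega\ \text{ for all } i\ge 1 \text{ with } q\nmid i\}.$$ Let $\mathbb P_\mu$ be the Borel probability measure on $\Sigma_m$ determined by $$\mathbb P_\mu[u]=\prod_{1\le i\le |u|,\ q\nmid i}\mu[u|J_i],\qquad u|J_i=u_iu_{qi}\cdots u_{q^ri},\quad q^ri\le |u|<q^{r+1}i,$$ for all finite words $u$; in other words, under $\mathbb P_\mu$ the sequences $(x_{iq^\ell})_{\ell\ge0}$, $q\nmid i$, are independent with law $\mu$. For $k\ge 1$ let $\alpha_k$ be the partition of $\Omega$ into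 the non-empty sets of the form $\Omega\cap[u]$, $|u|=k$, and let $H^\mu_m(\alpha_k)=-\sum_{C\in\alpha_k}\mu(C)\log_m\mu(C)$ (with $0\log_m 0=0$). Then the series in $$s(\Omega,\mu)=(q-1)^2\sum_{k=1}^\infty\frac{H_m^\mu(\alpha_k)}{q^{k+1}}$$ converges, and for $\mathbb P_\mu$-almost every $x$ we have $x\in X_\Omega$ and the pointwise dimension of $\mathbb P_\mu$ at $x$ exists and equals $s(\Omega,\mu)$: $$\dim_{\rm loc}(\mathbb P_\mu,x)=\lim_{r\to 0+}\frac{\log\mathbb P_\mu(B_r(x))}{\log r}=s(\Omega,\mu),$$ where $B_r(x)$ is the open ball of radius $r$ about $x$. Consequently $$\dim_H(\mathbb P_\mu)=s(\Omega,\mu)\qquad\text{and}\qquad \dim_H(X_\Omega)\ge s(\Omega,\mu),$$ where $\dim_H(\mathbb P_\mu)=\inf\{\dim_H(F):\ F\subset\Sigma_m \text{ Borel},\ \mathbb P_\mu(F)=1\}$ and $\dim_H$ of a set is its Hausdorff dimension with respect to $\varrho$. -/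

import Mathlib

open MeasureTheory Topology Filter

namespace MulFractal

/-- The sequence space `Σ_m` of sequences `(x_1, x_2, x_3, …)` over the alphabet `{0, …, m-1}`.
The coordinate with index `j : ℕ` is the letter `x_{j+1}`. -/
def SeqSpace (m : ℕ) : Type := ℕ → Fin m

namespace SeqSpace

variable {m : ℕ}

/-- The product topology of the discrete topologies. -/
instance : TopologicalSpace (SeqSpace m) := inferInstanceAs (TopologicalSpace (ℕ → Fin m))

/-- The product σ-algebra, which is the Borel σ-algebra (next instance). -/
instance : MeasurableSpace (SeqSpace m) := inferInstanceAs (MeasurableSpace (ℕ → Fin m))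

instance : BorelSpace (SeqSpace m) := inferInstanceAs (BorelSpace (ℕ → Fin m))

/-- The first index (counted from `0`) at which the coordinates of `x ≠ y` differ, which is
`min {n ≥ 1 : x_n ≠ y_n} - 1`. -/
noncomputable def firstDiff (x y : SeqSpace m) : ℕ := PiNat.firstDiff (E := fun _ => Fin m) x y

open Classical in
/-- The standard metric `ϱ(x, y) = m ^ (-min {n ≥ 1 : x_n ≠ y_n} + 1)` for `x ≠ y`, and `0` for
`x = y`. -/
noncomputable instance : Dist (SeqSpace m) :=
  ⟨fun x y => if x = y then 0 else ((m : ℝ)⁻¹) ^ firstDiff x y⟩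

theorem dist_of_ne {x y : SeqSpace m} (h : x ≠ y) :
    dist x y = ((m : ℝ)⁻¹) ^ firstDiff x y := if_neg h

theorem dist_self' (x : SeqSpace m) : dist x x = 0 := if_pos rfl

theorem two_le_of_ne {x y : SeqSpace m} (h : x ≠ y) : 2 ≤ m := by
  by_contra hm
  have : Subsingleton (Fin m) := Fin.subsingleton_iff_le_one.2 (by omega)
  exact h (funext fun _ => Subsingleton.elim _ _)

theorem inv_bounds {m : ℕ} (hm : 2 ≤ m) : 0 < (m : ℝ)⁻¹ ∧ (m : ℝ)⁻¹ < 1 := by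
  have : (2 : ℝ) ≤ m := by exact_mod_cast hm
  exact ⟨by positivity, inv_lt_one_of_one_lt₀ (by linarith)⟩

theorem dist_nonneg' (x y : SeqSpace m) : 0 ≤ dist x y := by
  by_cases h : x = y
  · rw [h, dist_self']
  · rw [dist_of_ne h]; positivity

theorem dist_comm' (x y : SeqSpace m) : dist x y = dist y x := by
  by_cases h : x = y
  · rw [h]
  · rw [dist_of_ne h, dist_of_ne (Ne.symm h), firstDiff, firstDiff]
    exact congrArg _ (PiNat.firstDiff_comm (E := fun _ => Fin m) x y)

theorem dist_triangle' (x y z : SeqSpace m) : dist x z ≤ dist x y + dist y z := by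
  by_cases hxz : x = z
  · rw [hxz, dist_self']; exact add_nonneg (dist_nonneg' _ _) (dist_nonneg' _ _)
  by_cases hxy : x = y
  · rw [hxy, dist_self', zero_add]
  by_cases hyz : y = z
  · rw [hyz, dist_self', add_zero]
  have hb := inv_bounds (two_le_of_ne hxz)
  have hmin := PiNat.min_firstDiff_le (E := fun _ => Fin m) x y z hxz
  have key : dist x z ≤ max (dist x y) (dist y z) := by
    rw [dist_of_ne hxz, dist_of_ne hxy, dist_of_ne hyz]
    rcases min_le_iff.1 hmin with h | h
    · exact le_max_of_le_left (pow_le_pow_of_le_one hb.1.le hb.2.le h)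
    · exact le_max_of_le_right (pow_le_pow_of_le_one hb.1.le hb.2.le h)
  exact key.trans (max_le_add_of_nonneg (dist_nonneg' _ _) (dist_nonneg' _ _))

theorem eq_of_dist_eq_zero' (x y : SeqSpace m) (h : dist x y = 0) : x = y := by
  by_contra hne
  rw [dist_of_ne hne] at h
  exact absurd h (pow_pos (inv_bounds (two_le_of_ne hne)).1 _).ne'

theorem isOpen_iff_dist' (s : Set (SeqSpace m)) :
    IsOpen s ↔ ∀ x ∈ s, ∃ ε > 0, ∀ y, dist x y < ε → y ∈ s := by
  constructor
  · intro hs x hx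
    obtain ⟨v, ⟨y, n, rfl⟩, h'x, h's⟩ :=
      (PiNat.isTopologicalBasis_cylinders (fun _ => Fin m)).exists_subset_of_mem_open hx hs
    rw [← PiNat.mem_cylinder_iff_eq.1 h'x] at h's
    by_cases hm : 2 ≤ m
    · refine ⟨((m : ℝ)⁻¹) ^ n, pow_pos (inv_bounds hm).1 _, fun y hy => ?_⟩
      by_cases hxy : x = y
      · rwa [← hxy]
      rw [dist_of_ne hxy] at hy
      have hlt := (pow_lt_pow_iff_right_of_lt_one₀ (inv_bounds hm).1 (inv_bounds hm).2).1 hy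
      exact h's fun i hi =>
        (PiNat.apply_eq_of_lt_firstDiff (E := fun _ => Fin m) (hi.trans hlt)).symm
    · refine ⟨1, one_pos, fun y _ => ?_⟩
      by_cases hxy : x = y
      · rwa [← hxy]
      · exact absurd (two_le_of_ne hxy) hm
  · intro h
    refine (PiNat.isTopologicalBasis_cylinders (fun _ => Fin m)).isOpen_iff.2 fun x hx => ?_
    obtain ⟨ε, εpos, hε⟩ := h x hx
    by_cases hm : 2 ≤ m
    · obtain ⟨n, hn⟩ := exists_pow_lt_of_lt_one εpos (inv_bounds hm).2
      refine ⟨PiNat.cylinder x n, ⟨x, n, rfl⟩, PiNat.self_mem_cylinder x n, fun y hy => hε y ?_⟩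
      by_cases hxy : x = y
      · rw [← hxy]; exact (dist_self' x).trans_lt εpos
      refine (dist_of_ne hxy).trans_lt ?_
      refine lt_of_le_of_lt (pow_le_pow_of_le_one (inv_bounds hm).1.le (inv_bounds hm).2.le ?_) hn
      exact (PiNat.mem_cylinder_iff_le_firstDiff (E := fun _ => Fin m) hxy n).1
        ((PiNat.mem_cylinder_comm (E := fun _ => Fin m) _ _ _).1 hy)
    · refine ⟨PiNat.cylinder x 0, ⟨x, 0, rfl⟩, PiNat.self_mem_cylinder x 0, fun y _ => ?_⟩
      by_cases hxy : x = y
      · rwa [← hxy]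
      · exact absurd (two_le_of_ne hxy) hm

/-- `Σ_m` as a metric space with the metric `ϱ`; its topology is the product topology. -/
noncomputable instance : MetricSpace (SeqSpace m) :=
  MetricSpace.ofDistTopology dist dist_self' dist_comm' dist_triangle'
    isOpen_iff_dist' eq_of_dist_eq_zero'

/-- The prefix `x_1 … x_n` of the sequence `x`. -/
def pre (x : SeqSpace m) (n : ℕ) : Fin n → Fin m := fun j => x j

/-- The subsequence `x|J_i = (x_i, x_{qi}, x_{q²i}, …)` along the geometric progression
`J_i = {i, qi, q²i, …}`; the letter `x_{i q^ℓ}` is the coordinate with index `i q^ℓ - 1`. -/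
def along (q i : ℕ) (x : SeqSpace m) : SeqSpace m := fun l => x (i * q ^ l - 1)

end SeqSpace

open SeqSpace

variable {m : ℕ}

/-- The cylinder `[u]` of all sequences which start with the word `u` of length `k`. -/
def cyl {k : ℕ} (u : Fin k → Fin m) : Set (SeqSpace m) := {x | pre x k = u}

/-- The set `X_Ω` of all `x ∈ Σ_m` such that `x|J_i ∈ Ω` for all `i ≥ 1` with `q ∤ i`. -/
def mulSubshift (q : ℕ) (Ω : Set (SeqSpace m)) : Set (SeqSpace m) :=
  {x | ∀ i : ℕ, 0 < i → ¬ q ∣ i → along q i x ∈ Ω}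

/-- Writing `n = q^r i` with `q ∤ i` for each `n ≥ 1`, this is the sequence whose letter at the
place `n` is the `(r+1)`-st letter of `ω i`. Thus `(weave q ω)|J_i = ω i` whenever `q ∤ i`; the
sequences `ω i` with `q ∣ i` are not used. -/
noncomputable def weave (q : ℕ) (ω : ℕ → SeqSpace m) : SeqSpace m :=
  fun k => ω ((k + 1) / q ^ multiplicity q (k + 1)) (multiplicity q (k + 1))

theorem measurable_weave (q : ℕ) : Measurable (weave (m := m) q) := by
  refine measurable_pi_lambda (X := fun _ : ℕ => Fin m) _ fun k => ?_
  exact (measurable_pi_apply (X := fun _ : ℕ => Fin m) (multiplicity q (k + 1))).comp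
    (measurable_pi_apply ((k + 1) / q ^ multiplicity q (k + 1)))

/-- The measure `ℙ_μ` on `Σ_m`: the law of `x` when the sequences `x|J_i`, `q ∤ i`, are independent
and each has the law `μ`. By `mulMeasure_cyl` below it is the (unique) Borel measure with
`ℙ_μ[u] = ∏_{i ≤ |u|, q ∤ i} μ[u|J_i]` for all words `u`. -/
noncomputable def mulMeasure (q : ℕ) (μ : Measure (SeqSpace m)) : Measure (SeqSpace m) :=
  (Measure.infinitePi fun _ : ℕ => μ).map (weave q)

instance (q : ℕ) (μ : Measure (SeqSpace m)) [IsProbabilityMeasure μ] :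
    IsProbabilityMeasure (mulMeasure q μ) :=
  Measure.isProbabilityMeasure_map (measurable_weave q).aemeasurable

theorem mem_cyl_pre {x y : SeqSpace m} {n : ℕ} :
    y ∈ cyl (pre x n) ↔ ∀ k < n, y k = x k := by
  constructor
  · intro h k hk
    exact congrFun h ⟨k, hk⟩
  · intro h
    exact funext fun j => h j j.2

theorem measurableSet_cyl {k : ℕ} (u : Fin k → Fin m) : MeasurableSet (cyl u) := by
  have h : Measurable fun x : SeqSpace m => pre x k :=
    measurable_pi_lambda _ fun j => measurable_pi_apply (X := fun _ : ℕ => Fin m) (j : ℕ)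
  exact h (measurableSet_singleton u)

theorem multiplicity_mul_pow {q : ℕ} (hq : 2 ≤ q) {i : ℕ} (hi : ¬ q ∣ i) (r : ℕ) :
    multiplicity q (i * q ^ r) = r := by
  refine multiplicity_eq_of_dvd_of_not_dvd (dvd_mul_left _ _) fun h => hi ?_
  rw [pow_succ', mul_comm i, mul_comm q] at h
  exact Nat.dvd_of_mul_dvd_mul_left (by positivity) h

/-- `ℙ_μ[u] = ∏_{i ≤ n, q ∤ i} μ[u|J_i]` for the word `u = x_1 … x_n`, where
`u|J_i = u_i u_{qi} … u_{q^r i}` with `q^r i ≤ n < q^{r+1} i`, that is, with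
`r = ⌊log_q (n / i)⌋`. -/
theorem mulMeasure_cyl {q : ℕ} (hq : 2 ≤ q) (μ : Measure (SeqSpace m)) [IsProbabilityMeasure μ]
    (x : SeqSpace m) (n : ℕ) :
    mulMeasure q μ (cyl (pre x n)) =
      ∏ i ∈ (Finset.Icc 1 n).filter (fun i => ¬ q ∣ i),
        μ (cyl (pre (along q i x) (Nat.log q (n / i) + 1))) := by
  rw [mulMeasure, Measure.map_apply (measurable_weave q) (measurableSet_cyl _),
    ← Measure.infinitePi_pi (fun _ : ℕ => μ) (fun _ _ => measurableSet_cyl _)]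
  congr 1
  ext ω
  simp only [Set.mem_preimage, mem_cyl_pre, Set.mem_pi, Finset.coe_filter, Finset.mem_Icc,
    Set.mem_ofPred_eq]
  constructor
  · rintro h i ⟨⟨hi1, hin⟩, hqi⟩ r hr
    have hpos : 0 < i * q ^ r := by positivity
    have hle : q ^ r ≤ n / i :=
      Nat.pow_le_of_le_log (Nat.div_pos hin hi1).ne' (Nat.lt_succ_iff.1 hr)
    have hle' : i * q ^ r ≤ n := by
      rw [mul_comm]; exact (Nat.le_div_iff_mul_le hi1).1 hle
    have h2 := h (i * q ^ r - 1) (by omega)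
    have h3 : i * q ^ r - 1 + 1 = i * q ^ r := by omega
    rw [weave, h3, multiplicity_mul_pow hq hqi,
      Nat.mul_div_cancel _ (by positivity : 0 < q ^ r)] at h2
    exact h2
  · intro h k hk
    have hfin : FiniteMultiplicity q (k + 1) :=
      Nat.finiteMultiplicity_iff.2 ⟨by omega, by omega⟩
    obtain ⟨i, hi, hqi⟩ := hfin.exists_eq_pow_mul_and_not_dvd
    set r := multiplicity q (k + 1) with hr
    have hqr : 0 < q ^ r := by positivity
    have hi1 : 0 < i := Nat.pos_of_ne_zero fun h0 => hqi (h0 ▸ dvd_zero q)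
    have hdiv : (k + 1) / q ^ r = i := by rw [hi, Nat.mul_div_cancel_left _ hqr]
    have hin : i ≤ n := (Nat.le_mul_of_pos_left i hqr).trans (by omega)
    have h2 := h i ⟨⟨hi1, hin⟩, hqi⟩ r (Nat.lt_succ_iff.2
      (Nat.le_log_of_pow_le (by omega) ((Nat.le_div_iff_mul_le hi1).2 (by omega))))
    rw [weave, ← hr, hdiv, h2, along]
    congr 1
    rw [mul_comm]
    omega

open Classical in
/-- The set `Pref_k(Ω)` of the words `u` of length `k` with `Ω ∩ [u] ≠ ∅`. -/
noncomputable def prefixes (Ω : Set (SeqSpace m)) (k : ℕ) : Finset (Fin k → Fin m) :=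
  Finset.univ.filter fun u => (Ω ∩ cyl u).Nonempty

/-- The entropy `-∑_{C ∈ α_k} μ(C) log_m μ(C)` of the partition
`α_k = {Ω ∩ [u] : u ∈ Pref_k(Ω)}` of `Ω` into cylinders of length `k`. -/
noncomputable def entropy (Ω : Set (SeqSpace m)) (μ : Measure (SeqSpace m)) (k : ℕ) : ℝ :=
  -∑ u ∈ prefixes Ω k, μ.real (Ω ∩ cyl u) * Real.logb m (μ.real (Ω ∩ cyl u))

/-- The term `H_m^μ(α_k) / q^(k+1)` of the series below, with `k = j + 1 ≥ 1`. -/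
noncomputable def sTerm (q : ℕ) (Ω : Set (SeqSpace m)) (μ : Measure (SeqSpace m)) (j : ℕ) : ℝ :=
  entropy Ω μ (j + 1) / (q : ℝ) ^ (j + 2)

/-- `s(Ω, μ) = (q - 1)² ∑_{k ≥ 1} H_m^μ(α_k) / q^(k+1)`. -/
noncomputable def sDim (q : ℕ) (Ω : Set (SeqSpace m)) (μ : Measure (SeqSpace m)) : ℝ :=
  ((q : ℝ) - 1) ^ 2 * ∑' j, sTerm q Ω μ j

/-- The pointwise dimension `lim_{r → 0+} log P(B_r(x)) / log r` of the finite measure `P` at `x`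
exists and equals the real number `d`; here `B_r(x)` is the open ball. (If some ball around `x`
has measure zero, then the pointwise dimension is `+∞` and hence not `d`.) -/
def HasLocalDim {X : Type*} [MetricSpace X] [MeasurableSpace X] (P : Measure X) (x : X) (d : ℝ) :
    Prop :=
  (∀ r : ℝ, 0 < r → 0 < P (Metric.ball x r)) ∧
    Tendsto (fun r : ℝ => Real.log (P.real (Metric.ball x r)) / Real.log r) (𝓝[>] 0) (𝓝 d)

/-- The Hausdorff dimension `inf {dim_H F : F Borel, P(F) = 1}` of a probability measure `P`. -/
noncomputable def dimHMeasure {X : Type*} [MetricSpace X] [MeasurableSpace X] (P : Measure X) :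
    ENNReal :=
  ⨅ (F : Set X) (_ : MeasurableSet F) (_ : P F = 1), dimH F

end MulFractal

namespace MulFractal

/-! ### Counting integers by the length of their geometric progression -/

/-! Write `k(i) = ⌊log_q (n/i)⌋ + 1` for the number of letters of `x_1 … x_n` along `J_i`. The
product formula turns `-log_m ℙ_μ[x_1 … x_n]` into a sum over `i ≤ n`, `q ∤ i`, of the independent
variables `-log_m μ[x|J_i up to length k(i)]`, with means `H(α_{k(i)})`. The indices with `k(i) = k`
have density `(q-1)²/q^(k+1)`, so the mean divided by `n` tends to `s(Ω, μ)`
(`tendsto_sum_progHeads_div`).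

The second moment of `-log_m μ[y_1 … y_k]` is `O(k²)` for every `μ` (`integral_logMass_sq_le`), so
the variance of the sum is `O(n)`. Along `n = j²` the normalised variances are summable, which gives
almost sure convergence. Monotonicity in `n` fills the gaps between squares
(`tendsto_div_of_monotone_of_tendsto_sq`).

Open balls of radius below `1` are cylinders, so this limit is the local dimension. The mass
distribution principle bounds dimensions from below (`le_dimH_of_ae_hasLocalDim`); covering by
cylinders of large mass bounds them from above (`dimH_le_of_tendsto_logMass`). -/

/-- The integers `1 ≤ i ≤ n` which are not divisible by `q`. -/
def progHeads (q n : ℕ) : Finset ℕ := (Finset.Icc 1 n).filter fun i => ¬ q ∣ i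

theorem mem_progHeads {q n i : ℕ} : i ∈ progHeads q n ↔ (1 ≤ i ∧ i ≤ n) ∧ ¬ q ∣ i := by
  simp [progHeads]

theorem card_progHeads_add (q n : ℕ) : (progHeads q n).card + n / q = n := by
  have h := Finset.card_filter_add_card_filter_not (s := Finset.Ioc 0 n) (fun i => q ∣ i)
  rw [Nat.Ioc_filter_dvd_card_eq_div, Nat.card_Ioc] at h
  have : progHeads q n = (Finset.Ioc 0 n).filter fun i => ¬ q ∣ i := by
    ext i; simp [progHeads, Nat.succ_le_iff]
  rw [this]; omega

theorem progHeads_mono (q : ℕ) : Monotone (progHeads q) := fun a b hab i hi => by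
  rw [mem_progHeads] at hi ⊢
  exact ⟨⟨hi.1.1, hi.1.2.trans hab⟩, hi.2⟩

theorem le_log_div_iff {q n i j : ℕ} (hq : 2 ≤ q) (hi : 1 ≤ i) (hin : i ≤ n) :
    j ≤ Nat.log q (n / i) ↔ i ≤ n / q ^ j := by
  rw [Nat.le_log_iff_pow_le (by omega) (Nat.div_pos hin hi).ne', Nat.le_div_iff_mul_le hi,
    Nat.le_div_iff_mul_le (by positivity), mul_comm]

/-- The condition `⌊log_q (n/i)⌋ = j` means `n/q^(j+1) < i ≤ n/q^j`. The additive form avoids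
truncated subtraction. -/
theorem card_progHeads_filter_log {q : ℕ} (hq : 2 ≤ q) (n j : ℕ) :
    ((progHeads q n).filter fun i => Nat.log q (n / i) = j).card
      + (progHeads q (n / q ^ (j + 1))).card = (progHeads q (n / q ^ j)).card := by
  have hle : n / q ^ (j + 1) ≤ n / q ^ j :=
    Nat.div_le_div_left (Nat.pow_le_pow_right (by omega) (by omega)) (by positivity)
  have hset : (progHeads q n).filter (fun i => Nat.log q (n / i) = j)
      = progHeads q (n / q ^ j) \ progHeads q (n / q ^ (j + 1)) := by
    ext i
    simp only [Finset.mem_filter, Finset.mem_sdiff, mem_progHeads]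
    have hn : n / q ^ j ≤ n := Nat.div_le_self _ _
    constructor
    · rintro ⟨⟨⟨h1, h2⟩, h3⟩, h4⟩
      have h5 := le_log_div_iff (j := j) hq h1 h2
      have h6 := le_log_div_iff (j := j + 1) hq h1 h2
      refine ⟨⟨⟨h1, h5.1 h4.ge⟩, h3⟩, fun h => ?_⟩
      have := h6.2 h.1.2
      omega
    · rintro ⟨⟨⟨h1, h2⟩, h3⟩, h4⟩
      have h5 := le_log_div_iff (j := j) hq h1 (h2.trans hn)
      have h6 := le_log_div_iff (j := j + 1) hq h1 (h2.trans hn)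
      refine ⟨⟨⟨h1, h2.trans hn⟩, h3⟩, le_antisymm ?_ (h5.2 h2)⟩
      by_contra h
      exact h4 ⟨⟨h1, h6.1 (by omega)⟩, h3⟩
  rw [hset, Finset.card_sdiff_add_card_eq_card (progHeads_mono q hle)]

theorem tendsto_natDiv_div_atTop (a : ℕ) :
    Tendsto (fun n : ℕ => ((n / a : ℕ) : ℝ) / n) atTop (𝓝 ((a : ℝ)⁻¹)) := by
  have h := (tendsto_nat_floor_mul_div_atTop (R := ℝ) (a := (a : ℝ)⁻¹) (by positivity)).comp
    tendsto_natCast_atTop_atTop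
  refine h.congr fun n => ?_
  simp only [Function.comp]
  rw [inv_mul_eq_div, Nat.floor_div_eq_div]

theorem tendsto_card_progHeads_div {q : ℕ} (a : ℕ) :
    Tendsto (fun n : ℕ => ((progHeads q (n / a)).card : ℝ) / n) atTop
      (𝓝 ((a : ℝ)⁻¹ - ((a * q : ℕ) : ℝ)⁻¹)) := by
  refine ((tendsto_natDiv_div_atTop a).sub (tendsto_natDiv_div_atTop (a * q))).congr fun n => ?_
  have h := card_progHeads_add q (n / a)
  rw [Nat.div_div_eq_div_mul] at h
  have h' : ((progHeads q (n / a)).card : ℝ) + ((n / (a * q) : ℕ) : ℝ) = ((n / a : ℕ) : ℝ) := by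
    exact_mod_cast h
  rw [← sub_div, ← h', add_sub_cancel_right]

/-- The density is the second difference `q^(-j) - 2 q^(-j-1) + q^(-j-2)`. -/
theorem tendsto_card_progHeads_filter_log_div {q : ℕ} (hq : 2 ≤ q) (j : ℕ) :
    Tendsto (fun n : ℕ => (((progHeads q n).filter fun i => Nat.log q (n / i) = j).card : ℝ) / n)
      atTop (𝓝 (((q : ℝ) - 1) ^ 2 / (q : ℝ) ^ (j + 2))) := by
  have hq0 : (q : ℝ) ≠ 0 := by positivity
  have h := (tendsto_card_progHeads_div (q := q) (q ^ j)).sub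
    (tendsto_card_progHeads_div (q := q) (q ^ (j + 1)))
  have hval : ((q : ℝ) - 1) ^ 2 / (q : ℝ) ^ (j + 2) = ((q ^ j : ℕ) : ℝ)⁻¹ - ((q ^ j * q : ℕ) : ℝ)⁻¹
      - (((q ^ (j + 1) : ℕ) : ℝ)⁻¹ - ((q ^ (j + 1) * q : ℕ) : ℝ)⁻¹) := by
    push_cast
    field_simp
    ring
  rw [hval]
  refine h.congr fun n => ?_
  have := card_progHeads_filter_log hq n j
  rw [← sub_div, ← this]
  push_cast
  ring

/-- This bound is uniform in `n` and serves as the dominating function for the limit of the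
averages. -/
theorem card_progHeads_filter_log_div_le {q : ℕ} (hq : 2 ≤ q) (n j : ℕ) :
    (((progHeads q n).filter fun i => Nat.log q (n / i) = j).card : ℝ) / n ≤ ((q : ℝ)⁻¹) ^ j := by
  have h1 := card_progHeads_filter_log hq n j
  have h2 := card_progHeads_add q (n / q ^ j)
  generalize n / q ^ j / q = a at h2
  have h3 : (((progHeads q n).filter fun i => Nat.log q (n / i) = j).card : ℝ)
      ≤ ((n / q ^ j : ℕ) : ℝ) := by
    exact_mod_cast (by omega : ((progHeads q n).filter fun i => Nat.log q (n / i) = j).card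
      ≤ n / q ^ j)
  have h4 : ((n / q ^ j : ℕ) : ℝ) ≤ (n : ℝ) / ((q ^ j : ℕ) : ℝ) := Nat.cast_div_le
  rcases Nat.eq_zero_or_pos n with rfl | hn
  · simp
  · rw [div_le_iff₀ (by positivity)]
    refine (h3.trans h4).trans (le_of_eq ?_)
    push_cast
    rw [inv_pow, div_eq_inv_mul]

/-- Averages over the integers not divisible by `q` of a function of polynomial growth of the
number of terms up to `n` of their geometric progression. -/
theorem tendsto_sum_progHeads_div {q : ℕ} (hq : 2 ≤ q) {h : ℕ → ℝ} {C : ℝ}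
    (hC : ∀ k, |h (k + 1)| ≤ C * ((k : ℝ) + 1) ^ 2) :
    Summable (fun j => h (j + 1) / (q : ℝ) ^ (j + 2)) ∧
    Tendsto (fun n : ℕ => (∑ i ∈ progHeads q n, h (Nat.log q (n / i) + 1)) / n) atTop
      (𝓝 (((q : ℝ) - 1) ^ 2 * ∑' j, h (j + 1) / (q : ℝ) ^ (j + 2))) := by
  have hq2 : (2 : ℝ) ≤ q := by exact_mod_cast hq
  have hq0 : (0 : ℝ) < q := by linarith
  have hr : ‖(q : ℝ)⁻¹‖ < 1 := by
    rw [norm_inv, Real.norm_of_nonneg hq0.le]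
    exact inv_lt_one_of_one_lt₀ (by linarith)
  have hsum : Summable fun j : ℕ => ((q : ℝ)⁻¹) ^ j * (C * ((j : ℝ) + 1) ^ 2) := by
    have s0 := summable_pow_mul_geometric_of_norm_lt_one 0 hr
    have s1 := summable_pow_mul_geometric_of_norm_lt_one 1 hr
    have s2 := summable_pow_mul_geometric_of_norm_lt_one 2 hr
    refine (((s2.add (s1.mul_left 2)).add s0).mul_left C).congr fun j => ?_
    simp only [pow_zero, pow_one]
    ring
  constructor
  · refine Summable.of_norm_bounded hsum fun j => ?_
    rw [Real.norm_eq_abs, abs_div, abs_of_pos (by positivity : (0 : ℝ) < (q : ℝ) ^ (j + 2)),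
      inv_pow, ← div_eq_inv_mul]
    have h1 := (abs_nonneg _).trans (hC j)
    gcongr
    · exact hC j
    · linarith
    · omega
  -- Group the `i` by `j = ⌊log_q (n/i)⌋`. The geometric decay of the group densities beats the
  -- quadratic growth of `h`, so the limit passes inside the sum over `j`.
  · have key := tendsto_tsum_of_dominated_convergence
      (f := fun (n : ℕ) (j : ℕ) =>
        (((progHeads q n).filter fun i => Nat.log q (n / i) = j).card : ℝ) / n * h (j + 1))
      (g := fun j => ((q : ℝ) - 1) ^ 2 / (q : ℝ) ^ (j + 2) * h (j + 1)) (𝓕 := atTop) hsum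
      (fun j => (tendsto_card_progHeads_filter_log_div hq j).mul_const _)
      (Eventually.of_forall fun n j => by
        rw [norm_mul, Real.norm_of_nonneg (by positivity), Real.norm_eq_abs]
        exact mul_le_mul (card_progHeads_filter_log_div_le hq n j) (hC j) (abs_nonneg _)
          (by positivity))
    have hlim : ((q : ℝ) - 1) ^ 2 * ∑' j, h (j + 1) / (q : ℝ) ^ (j + 2)
        = ∑' j : ℕ, ((q : ℝ) - 1) ^ 2 / (q : ℝ) ^ (j + 2) * h (j + 1) := by
      rw [← tsum_mul_left]
      exact tsum_congr fun j => by ring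
    rw [hlim]
    refine key.congr fun n => ?_
    have hmaps : ∀ i ∈ progHeads q n, Nat.log q (n / i) ∈ Finset.range (n + 1) := fun i _ => by
      rw [Finset.mem_range, Nat.lt_succ_iff]
      exact (Nat.log_le_self _ _).trans (Nat.div_le_self _ _)
    rw [tsum_eq_sum (s := Finset.range (n + 1)), ← Finset.sum_fiberwise_of_maps_to hmaps,
      Finset.sum_div]
    · refine Finset.sum_congr rfl fun j _ => ?_
      rw [Finset.sum_congr rfl (g := fun _ => h (j + 1))
        (fun i hi => by rw [(Finset.mem_filter.1 hi).2]), Finset.sum_const, nsmul_eq_mul]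
      ring
    · intro j hj
      rw [Finset.filter_false_of_mem fun i hi (hij : Nat.log q (n / i) = j) => hj (hij ▸ hmaps i hi)]
      simp

/-! ### Local dimension and Hausdorff dimension -/

/-- Mass distribution principle: if `P(B_r(x)) ≤ r^t` for all small `r`, for the points `x` of a
set of positive measure, then this set has dimension at least `t`. -/
theorem le_dimH_of_measure_ball_le {X : Type*} [MetricSpace X] [MeasurableSpace X] [BorelSpace X]
    {P : Measure X} {E : Set X} (hE : P E ≠ 0) {t : NNReal} {ρ : ℝ} (hρ : 0 < ρ)
    (hball : ∀ x ∈ E, ∀ r : ℝ, 0 < r → r < ρ → P (Metric.ball x r) ≤ ENNReal.ofReal r ^ (t : ℝ)) :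
    (t : ENNReal) ≤ dimH E := by
  refine le_dimH_of_hausdorffMeasure_ne_zero ?_
  -- It suffices to compare with `diam^t` on small sets `s`. Passing to the closure keeps the
  -- diameter and makes the set measurable.
  have hle : P.restrict E ≤ Measure.hausdorffMeasure (t : ℝ) := by
    refine Measure.le_hausdorffMeasure _ _ (ENNReal.ofReal (ρ / 2))
      (ENNReal.ofReal_pos.2 (by positivity)) fun s hs => ?_
    refine (measure_mono (subset_closure (s := s))).trans ?_
    rw [Measure.restrict_apply isClosed_closure.measurableSet]
    rcases (closure s ∩ E).eq_empty_or_nonempty with h0 | ⟨x, hxs, hxE⟩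
    · rw [h0, measure_empty]; exact zero_le
    have hfin : Metric.ediam (closure s) ≠ ⊤ := by
      rw [Metric.ediam_closure]; exact (hs.trans_lt ENNReal.ofReal_lt_top).ne
    set δ := (Metric.ediam (closure s)).toReal with hδ
    have hδρ : δ < ρ := by
      have : δ ≤ ρ / 2 := by
        rw [Metric.ediam_closure] at hδ
        exact hδ ▸ ENNReal.toReal_le_of_le_ofReal (by positivity) hs
      linarith
    have hδ0 : 0 ≤ δ := ENNReal.toReal_nonneg
    -- An open ball of radius exactly `δ` may miss points at distance `δ`; hence larger radii first,
    -- then `r ↓ δ`.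
    have hbd : ∀ r : ℝ, δ < r → r < ρ → P (closure s ∩ E) ≤ ENNReal.ofReal r ^ (t : ℝ) := by
      intro r h1 h2
      refine (measure_mono fun y hy => ?_).trans (hball x hxE r (hδ0.trans_lt h1) h2)
      rw [Metric.mem_ball]
      refine lt_of_le_of_lt ?_ h1
      rw [dist_edist]
      exact ENNReal.toReal_mono hfin (Metric.edist_le_ediam_of_mem hy.1 hxs)
    have hlim : Tendsto (fun r : ℝ => ENNReal.ofReal r ^ (t : ℝ)) (𝓝[>] δ)
        (𝓝 (ENNReal.ofReal δ ^ (t : ℝ))) :=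
      ((ENNReal.continuous_rpow_const.comp ENNReal.continuous_ofReal).tendsto δ).mono_left
        nhdsWithin_le_nhds
    have := ge_of_tendsto hlim (by
      filter_upwards [Ioo_mem_nhdsGT hδρ] with r hr using hbd r hr.1 hr.2)
    rwa [hδ, ENNReal.ofReal_toReal hfin, Metric.ediam_closure] at this
  have h := hle E
  rw [Measure.restrict_apply_self] at h
  exact fun h0 => hE (le_antisymm (h0 ▸ h) zero_le)

theorem HasLocalDim.eventually_measure_ball_le {X : Type*} [MetricSpace X] [MeasurableSpace X]
    {P : Measure X} [IsFiniteMeasure P] {x : X} {s t : ℝ} (h : HasLocalDim P x s) (hts : t < s) :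
    ∃ ρ : ℝ, 0 < ρ ∧ ∀ r : ℝ, 0 < r → r < ρ → P (Metric.ball x r) ≤ ENNReal.ofReal r ^ t := by
  have h1 := h.2.eventually_const_lt hts
  rw [eventually_nhdsWithin_iff, Metric.eventually_nhds_iff] at h1
  obtain ⟨ε, hε, h2⟩ := h1
  refine ⟨min ε 1, lt_min hε one_pos, fun r hr0 hr => ?_⟩
  have hr1 : r < 1 := hr.trans_le (min_le_right _ _)
  have h3 := h2 (y := r) (by
    rw [Real.dist_eq, sub_zero, abs_of_pos hr0]; exact hr.trans_le (min_le_left _ _)) hr0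
  have hP : 0 < P.real (Metric.ball x r) :=
    ENNReal.toReal_pos (h.1 r hr0).ne' (measure_ne_top _ _)
  rw [lt_div_iff_of_neg (Real.log_neg hr0 hr1), ← Real.log_rpow hr0,
    Real.log_lt_log_iff hP (by positivity)] at h3
  rw [ENNReal.ofReal_rpow_of_pos hr0, ← ofReal_measureReal]
  exact ENNReal.ofReal_le_ofReal h3.le

/-- A set of positive measure has at least the almost everywhere local dimension. -/
theorem le_dimH_of_ae_hasLocalDim {X : Type*} [MetricSpace X] [MeasurableSpace X] [BorelSpace X]
    {P : Measure X} [IsFiniteMeasure P] {s : ℝ} (h : ∀ᵐ x ∂P, HasLocalDim P x s)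
    {F : Set X} (hF : P F ≠ 0) : ENNReal.ofReal s ≤ dimH F := by
  refine le_of_forall_lt fun c hc => ?_
  obtain ⟨t, hct, hts⟩ := ENNReal.lt_iff_exists_nnreal_btwn.1 hc
  refine hct.trans_le ?_
  have hts' : (t : ℝ) < s := by
    rw [ENNReal.lt_ofReal_iff_toReal_lt ENNReal.coe_ne_top] at hts
    exact hts
  -- The threshold radius depends on the point. Countably many sets with a uniform threshold cover
  -- `F` up to a null set, so one of them has positive outer measure.
  let E : ℕ → Set X := fun N => {x ∈ F | ∀ r : ℝ, 0 < r → r < 1 / ((N : ℝ) + 1) →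
    P (Metric.ball x r) ≤ ENNReal.ofReal r ^ (t : ℝ)}
  have hcov : F ⊆ (⋃ N, E N) ∪ {x | ¬ HasLocalDim P x s} := by
    intro x hx
    by_cases hd : HasLocalDim P x s
    · obtain ⟨ρ, hρ, hb⟩ := hd.eventually_measure_ball_le hts'
      obtain ⟨N, hN⟩ := exists_nat_one_div_lt hρ
      exact Or.inl (Set.mem_iUnion.2 ⟨N, hx, fun r h0 h1 => hb r h0 (h1.trans hN)⟩)
    · exact Or.inr hd
  have : ∃ N, P (E N) ≠ 0 := by
    by_contra! hnull
    refine hF (measure_mono_null hcov (measure_union_null (measure_iUnion_null hnull) ?_))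
    exact ae_iff.1 h
  obtain ⟨N, hN⟩ := this
  exact (le_dimH_of_measure_ball_le hN (by positivity) fun x hx => hx.2).trans
    (dimH_mono fun x hx => hx.1)

open SeqSpace

variable {m : ℕ}

/-! ### Balls of the sequence space -/

theorem dist_le_pow_of_mem_cyl (hm : 2 ≤ m) {x y : SeqSpace m} {n : ℕ} (h : y ∈ cyl (pre x n)) :
    dist y x ≤ ((m : ℝ)⁻¹) ^ n := by
  have hb := inv_bounds hm
  by_cases hyx : y = x
  · rw [hyx, dist_self]; positivity
  · rw [dist_of_ne hyx]
    exact pow_le_pow_of_le_one hb.1.le hb.2.le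
      ((PiNat.mem_cylinder_iff_le_firstDiff (E := fun _ => Fin m) hyx n).1 (mem_cyl_pre.1 h))

theorem ediam_cyl_le (hm : 2 ≤ m) {n : ℕ} (u : Fin n → Fin m) :
    Metric.ediam (cyl u) ≤ ENNReal.ofReal (((m : ℝ)⁻¹) ^ n) := by
  refine Metric.ediam_le_of_forall_dist_le fun x hx y hy => dist_le_pow_of_mem_cyl hm ?_
  rw [show pre y n = u from hy]
  exact hx

/-- For an integer `f`, `m^(-f) < r` means `f > -log_m r`, that is, `f ≥ ⌊-log_m r⌋ + 1`. -/
theorem ball_eq_cyl (hm : 2 ≤ m) (x : SeqSpace m) {r : ℝ} (h0 : 0 < r) (h1 : r < 1) :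
    Metric.ball x r = cyl (pre x (⌊-Real.logb m r⌋₊ + 1)) := by
  have hm1 : (1 : ℝ) < m := by exact_mod_cast (by omega : 1 < m)
  have hL : 0 ≤ -Real.logb m r := neg_nonneg.2 (Real.logb_neg hm1 h0 h1).le
  ext y
  by_cases hyx : y = x
  · rw [hyx]
    exact iff_of_true (Metric.mem_ball_self h0) rfl
  · have h2 := PiNat.mem_cylinder_iff_le_firstDiff (E := fun _ => Fin m) hyx
      (⌊-Real.logb m r⌋₊ + 1)
    rw [Nat.succ_le_iff, Nat.floor_lt hL] at h2
    rw [Metric.mem_ball, dist_of_ne hyx, mem_cyl_pre]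
    refine Iff.trans ?_ h2.symm
    rw [neg_lt, Real.lt_logb_iff_rpow_lt hm1 h0, Real.rpow_neg (by positivity), Real.rpow_natCast,
      inv_pow, firstDiff]

/-- The function `n ↦ -log_m P[x_1 … x_n]`. -/
noncomputable def logMass (P : Measure (SeqSpace m)) (x : SeqSpace m) (n : ℕ) : ℝ :=
  -Real.logb m (P.real (cyl (pre x n)))

theorem measurable_comp_pre {β : Type*} [MeasurableSpace β] {n : ℕ} (f : (Fin n → Fin m) → β) :
    Measurable fun x : SeqSpace m => f (pre x n) :=
  (measurable_of_finite f).comp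
    (measurable_pi_lambda _ fun j => measurable_pi_apply (X := fun _ : ℕ => Fin m) (j : ℕ))

theorem measurable_logMass (P : Measure (SeqSpace m)) (n : ℕ) :
    Measurable fun x => logMass P x n :=
  measurable_comp_pre fun u => -Real.logb m (P.real (cyl u))

theorem logMass_monotone (hm : 2 ≤ m) {P : Measure (SeqSpace m)} [IsFiniteMeasure P]
    {x : SeqSpace m} (hpos : ∀ n, P (cyl (pre x n)) ≠ 0) : Monotone (logMass P x) := by
  intro a b hab
  have hm1 : (1 : ℝ) < m := by exact_mod_cast (by omega : 1 < m)
  refine neg_le_neg (Real.logb_le_logb_of_le hm1 ?_ (measureReal_mono fun y hy => ?_))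
  · exact ENNReal.toReal_pos (hpos b) (measure_ne_top _ _)
  · rw [mem_cyl_pre] at hy ⊢
    exact fun k hk => hy k (hk.trans_le hab)

/-- Each length has only finitely many null cylinders. Off them `logMass` is a genuine logarithm
rather than the default `logb 0 = 0`. -/
theorem ae_measure_cyl_ne_zero (P : Measure (SeqSpace m)) :
    ∀ᵐ x ∂P, ∀ n, P (cyl (pre x n)) ≠ 0 := by
  rw [ae_all_iff]
  intro n
  rw [ae_iff]
  have : {x : SeqSpace m | ¬ P (cyl (pre x n)) ≠ 0}
      = ⋃ u : {u : Fin n → Fin m // P (cyl u) = 0}, cyl u.1 := by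
    ext x
    simp only [not_not, Set.mem_ofPred_eq, Set.mem_iUnion]
    constructor
    · exact fun h => ⟨⟨pre x n, h⟩, rfl⟩
    · rintro ⟨⟨u, hu⟩, hx⟩
      rw [show pre x n = u from hx, hu]
  rw [this]
  exact measure_iUnion_null fun u => u.2

/-- The local dimension can be computed along cylinders. -/
theorem hasLocalDim_of_tendsto_logMass (hm : 2 ≤ m) {P : Measure (SeqSpace m)} {x : SeqSpace m}
    {s : ℝ} (hpos : ∀ n, P (cyl (pre x n)) ≠ 0)
    (hlim : Tendsto (fun n => logMass P x n / n) atTop (𝓝 s)) : HasLocalDim P x s := by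
  have hm1 : (1 : ℝ) < m := by exact_mod_cast (by omega : 1 < m)
  constructor
  · intro r hr
    have h0 : 0 < min r (1 / 2) := lt_min hr (by norm_num)
    have h1 : min r (1 / 2) < 1 := (min_le_right _ _).trans_lt (by norm_num)
    refine lt_of_lt_of_le ?_ (measure_mono (Metric.ball_subset_ball (min_le_left r (1 / 2))))
    rw [ball_eq_cyl hm x h0 h1]
    exact pos_iff_ne_zero.2 (hpos _)
  · have hL : Tendsto (fun r : ℝ => -Real.logb m r) (𝓝[>] 0) atTop :=
      tendsto_neg_atBot_atTop.comp (Real.tendsto_logb_nhdsGT_zero hm1)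
    have hN : Tendsto (fun r : ℝ => ⌊-Real.logb m r⌋₊ + 1) (𝓝[>] 0) atTop :=
      (tendsto_add_atTop_nat 1).comp (tendsto_nat_floor_atTop.comp hL)
    -- The cylinder length attached to `r` is asymptotic to `-log_m r`, so rounding does not affect
    -- the limit.
    have hratio : Tendsto (fun r : ℝ => ((⌊-Real.logb m r⌋₊ + 1 : ℕ) : ℝ) / (-Real.logb m r))
        (𝓝[>] 0) (𝓝 1) := by
      have := ((tendsto_nat_floor_div_atTop (R := ℝ)).comp hL).add (tendsto_inv_atTop_zero.comp hL)
      rw [add_zero] at this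
      refine this.congr fun r => ?_
      simp only [Function.comp]
      push_cast
      ring
    have := (hlim.comp hN).mul hratio
    rw [mul_one] at this
    refine this.congr' ?_
    filter_upwards [Ioo_mem_nhdsGT (zero_lt_one (α := ℝ))] with r hr
    rw [ball_eq_cyl hm x hr.1 hr.2]
    simp only [Function.comp, logMass]
    have h3 : Real.logb m r ≠ 0 := (Real.logb_neg hm1 hr.1 hr.2).ne
    have h4 : ((⌊-Real.logb m r⌋₊ + 1 : ℕ) : ℝ) ≠ 0 := by positivity
    have h5 : Real.log m ≠ 0 := (Real.log_pos hm1).ne'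
    have h6 : Real.log r ≠ 0 := (Real.log_neg hr.1 hr.2).ne
    rw [div_mul_div_cancel₀ h4, neg_div_neg_eq]
    simp only [Real.logb]
    rw [div_div_div_cancel_right₀ h5]

/-- A set on which the mass of the cylinders of length `n` is at least `m ^ (-t n)` has dimension
at most `t`. -/
theorem dimH_le_of_logMass_le (hm : 2 ≤ m) {P : Measure (SeqSpace m)} [IsProbabilityMeasure P]
    {t : NNReal} (ht : 0 < t) {E : Set (SeqSpace m)} {N : ℕ}
    (hE : ∀ x ∈ E, ∀ n ≥ N, P (cyl (pre x n)) ≠ 0 ∧ logMass P x n ≤ t * n) :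
    dimH E ≤ t := by
  classical
  have hm1 : (1 : ℝ) < m := by exact_mod_cast (by omega : 1 < m)
  have hb := inv_bounds hm
  refine dimH_le_of_hausdorffMeasure_ne_top (ne_top_of_le_ne_top ENNReal.one_ne_top ?_)
  let δ : ℕ → ENNReal := fun n => ENNReal.ofReal (((m : ℝ)⁻¹) ^ n)
  -- Only cylinders of mass at least `m^(-tn)` are kept. They cover `E` once `n ≥ N`, and their
  -- `diam^t` sum to at most the total mass `1`.
  let T : ∀ n : ℕ, (Fin n → Fin m) → Set (SeqSpace m) := fun n u =>
    if δ n ^ (t : ℝ) ≤ P (cyl u) then cyl u else ∅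
  have hδ : Tendsto δ atTop (𝓝 0) := by
    rw [← ENNReal.ofReal_zero]
    exact ENNReal.tendsto_ofReal (tendsto_pow_atTop_nhds_zero_of_lt_one hb.1.le hb.2)
  have hdiam : ∀ n u, Metric.ediam (T n u) ≤ δ n := by
    intro n u
    by_cases h : δ n ^ (t : ℝ) ≤ P (cyl u)
    · simp only [T, if_pos h]; exact ediam_cyl_le hm u
    · simp only [T, if_neg h, Metric.ediam_empty]; exact zero_le
  refine (Measure.hausdorffMeasure_le_liminf_sum (t : ℝ) E δ hδ T (Eventually.of_forall hdiam)
    ?_).trans ?_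
  · filter_upwards [eventually_ge_atTop N] with n hn x hx
    refine Set.mem_iUnion.2 ⟨pre x n, ?_⟩
    obtain ⟨h0, h1⟩ := hE x hx n hn
    have h2 : δ n ^ (t : ℝ) ≤ P (cyl (pre x n)) := by
      have h3 : 0 < P.real (cyl (pre x n)) := ENNReal.toReal_pos h0 (measure_ne_top _ _)
      rw [logMass, neg_le, Real.le_logb_iff_rpow_le hm1 h3] at h1
      rw [ENNReal.ofReal_rpow_of_pos (pow_pos hb.1 n), ← ofReal_measureReal]
      refine ENNReal.ofReal_le_ofReal (le_trans (le_of_eq ?_) h1)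
      rw [inv_pow, ← Real.rpow_natCast, ← Real.rpow_neg (by positivity),
        ← Real.rpow_mul (by positivity)]
      congr 1
      ring
    simp only [T, if_pos h2]
    exact rfl
  · refine Filter.liminf_le_of_frequently_le' (Frequently.of_forall fun n => ?_)
    have hterm : ∀ u, Metric.ediam (T n u) ^ (t : ℝ) ≤ P (cyl u) := by
      intro u
      by_cases h : δ n ^ (t : ℝ) ≤ P (cyl u)
      · exact (ENNReal.rpow_le_rpow (hdiam n u) t.2).trans h
      · simp only [T, if_neg h, Metric.ediam_empty]
        rw [ENNReal.zero_rpow_of_pos (by exact_mod_cast ht)]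
        exact zero_le
    refine (Finset.sum_le_sum fun u _ => hterm u).trans ?_
    have := sum_measure_preimage_singleton (μ := P) (Finset.univ : Finset (Fin n → Fin m))
      (f := fun x : SeqSpace m => pre x n) (fun u _ => measurableSet_cyl u)
    exact this.le.trans prob_le_one

theorem dimH_le_of_tendsto_logMass (hm : 2 ≤ m) {P : Measure (SeqSpace m)} [IsProbabilityMeasure P]
    {s : ℝ} {G : Set (SeqSpace m)}
    (hpos : ∀ x ∈ G, ∀ n, P (cyl (pre x n)) ≠ 0)
    (hlim : ∀ x ∈ G, Tendsto (fun n => logMass P x n / n) atTop (𝓝 s)) :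
    dimH G ≤ ENNReal.ofReal s := by
  refine le_of_forall_gt fun c hc => ?_
  obtain ⟨t, hst, htc⟩ := ENNReal.lt_iff_exists_nnreal_btwn.1 hc
  refine lt_of_le_of_lt ?_ htc
  have ht0 : 0 < t := by exact_mod_cast zero_le.trans_lt hst
  have hst' : s < t := by
    by_contra! h
    exact hst.not_ge (ENNReal.ofReal_coe_nnreal ▸ ENNReal.ofReal_le_ofReal h)
  have hcov : G ⊆ ⋃ N : ℕ, {x ∈ G | ∀ n ≥ N, logMass P x n ≤ t * n} := by
    intro x hx
    obtain ⟨N, hN⟩ := eventually_atTop.1 ((hlim x hx).eventually_lt_const hst')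
    -- The shift by one excludes `n = 0`, where division by `n` says nothing.
    refine Set.mem_iUnion.2 ⟨N + 1, hx, fun n hn => ?_⟩
    have hn0 : (0 : ℝ) < n := by exact_mod_cast (by omega : 0 < n)
    exact ((div_lt_iff₀ hn0).1 (hN n (by omega))).le
  refine (dimH_mono hcov).trans ?_
  rw [dimH_iUnion]
  exact iSup_le fun N => dimH_le_of_logMass_le hm ht0 (N := N)
    fun x hx n hn => ⟨hpos x hx.1 n, hx.2 n hn⟩

/-! ### Moments of the information function -/

theorem memLp_comp_pre (μ : Measure (SeqSpace m)) [IsFiniteMeasure μ] {n : ℕ}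
    (f : (Fin n → Fin m) → ℝ) (p : ENNReal) : MemLp (fun x : SeqSpace m => f (pre x n)) p μ :=
  MemLp.of_bound (measurable_comp_pre f).aestronglyMeasurable (∑ u, |f u|)
    (Eventually.of_forall fun x => Finset.single_le_sum (f := fun u => |f u|)
      (fun u _ => abs_nonneg (f u)) (Finset.mem_univ (pre x n)))

theorem integral_comp_pre (μ : Measure (SeqSpace m)) [IsFiniteMeasure μ] {n : ℕ}
    (f : (Fin n → Fin m) → ℝ) :
    ∫ x, f (pre x n) ∂μ = ∑ u, μ.real (cyl u) * f u := by
  have hpre : Measurable fun x : SeqSpace m => pre x n := measurable_comp_pre fun u => u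
  rw [← integral_map (f := f) hpre.aemeasurable (measurable_of_finite f).aestronglyMeasurable,
    integral_fintype (Integrable.of_finite)]
  refine Finset.sum_congr rfl fun u _ => ?_
  rw [map_measureReal_apply hpre (measurableSet_singleton u), smul_eq_mul]
  rfl

theorem memLp_logMass (μ : Measure (SeqSpace m)) [IsFiniteMeasure μ] (n : ℕ) (p : ENNReal) :
    MemLp (fun x => logMass μ x n) p μ :=
  memLp_comp_pre μ (fun u => -Real.logb m (μ.real (cyl u))) p

theorem integral_logMass {Ω : Set (SeqSpace m)} {μ : Measure (SeqSpace m)} [IsProbabilityMeasure μ]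
    (hμ : ∀ᵐ x ∂μ, x ∈ Ω) (n : ℕ) : ∫ x, logMass μ x n ∂μ = entropy Ω μ n := by
  classical
  have hcyl : ∀ u : Fin n → Fin m, μ.real (Ω ∩ cyl u) = μ.real (cyl u) := fun u =>
    measureReal_congr (by
      filter_upwards [hμ] with x hx
      exact propext ⟨fun h => h.2, fun h => ⟨hx, h⟩⟩)
  have h := integral_comp_pre μ (n := n) fun u => -Real.logb m (μ.real (cyl u))
  refine h.trans ?_
  rw [entropy, ← Finset.sum_neg_distrib, prefixes]
  refine (Finset.sum_congr rfl fun u _ => ?_).trans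
    (Finset.sum_subset (Finset.filter_subset _ _) fun u _ hu => ?_).symm
  · rw [hcyl, mul_neg]
  · have : Ω ∩ cyl u = ∅ := by
      simpa [Set.not_nonempty_iff_eq_empty] using hu
    rw [this, measureReal_empty]
    simp

/-- Split at `p = N^(-2)`. Above it `|log p| ≤ 2 log N`; below it `|p^(1/4) log p| < 4` and `√p ≤
1/N`. With `N = m^k`, the number of words of length `k`, the errors `16/N` sum to `16`. -/
theorem mul_log_sq_le {p N : ℝ} (hp0 : 0 ≤ p) (hp1 : p ≤ 1) (hN : 1 ≤ N) :
    p * Real.log p ^ 2 ≤ 4 * Real.log N ^ 2 * p + 16 / N := by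
  have hN0 : 0 < N := by linarith
  rcases hp0.eq_or_lt with rfl | hp
  · simp only [zero_mul, mul_zero, zero_add]; positivity
  rcases le_total (N ^ 2 * p) 1 with h | h
  · have h1 := Real.abs_log_mul_self_rpow_lt p (1 / 4) hp hp1 (by norm_num)
    have h2 : (Real.log p * p ^ (1 / 4 : ℝ)) ^ 2 ≤ 16 := by
      rw [← sq_abs]
      nlinarith [abs_nonneg (Real.log p * p ^ (1 / 4 : ℝ))]
    have h3 : (p ^ (1 / 4 : ℝ)) ^ 2 = √p := by
      rw [← Real.rpow_natCast, ← Real.rpow_mul hp0, Real.sqrt_eq_rpow]; norm_num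
    have h4 : √p ≤ 1 / N := by
      rw [Real.sqrt_le_left (by positivity), div_pow, one_pow, le_div_iff₀ (by positivity)]
      linarith
    have h5 : p * Real.log p ^ 2 = √p * (Real.log p * p ^ (1 / 4 : ℝ)) ^ 2 := by
      rw [mul_pow, h3]
      nth_rewrite 1 [← Real.mul_self_sqrt hp0]
      ring
    have h6 : √p * (Real.log p * p ^ (1 / 4 : ℝ)) ^ 2 ≤ 1 / N * 16 :=
      mul_le_mul h4 h2 (by positivity) (by positivity)
    have h7 : 0 ≤ 4 * Real.log N ^ 2 * p := by positivity
    have h8 : 1 / N * 16 = 16 / N := by ring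
    linarith
  · have h1 : 0 ≤ Real.log (N ^ 2 * p) := Real.log_nonneg h
    rw [Real.log_mul (by positivity) hp.ne', Real.log_pow] at h1
    push_cast at h1
    have h2 : Real.log p ≤ 0 := Real.log_nonpos hp0 hp1
    have h3 : Real.log p ^ 2 ≤ 4 * Real.log N ^ 2 := by nlinarith
    have h4 : 0 ≤ 16 / N := by positivity
    nlinarith

theorem integral_logMass_sq_le (hm : 2 ≤ m) (μ : Measure (SeqSpace m)) [IsProbabilityMeasure μ]
    (k : ℕ) :
    ∫ x, logMass μ x k ^ 2 ∂μ ≤ 4 * (k : ℝ) ^ 2 + 16 / Real.log m ^ 2 := by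
  have hm1 : (1 : ℝ) < m := by exact_mod_cast (by omega : 1 < m)
  have hlog : 0 < Real.log m := Real.log_pos hm1
  have hN : (1 : ℝ) ≤ (m : ℝ) ^ k := one_le_pow₀ hm1.le
  have h := integral_comp_pre μ (n := k) fun u => (-Real.logb m (μ.real (cyl u))) ^ 2
  refine h.le.trans ?_
  have hterm : ∀ u : Fin k → Fin m, μ.real (cyl u) * (-Real.logb m (μ.real (cyl u))) ^ 2
      ≤ 4 * (k : ℝ) ^ 2 * μ.real (cyl u) + 16 / Real.log m ^ 2 / (m : ℝ) ^ k := by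
    intro u
    have h1 := mul_log_sq_le (measureReal_nonneg (μ := μ) (s := cyl u)) measureReal_le_one hN
    rw [Real.log_pow] at h1
    rw [neg_sq, Real.logb, div_pow, ← mul_div_assoc, div_le_iff₀ (by positivity)]
    refine h1.trans (le_of_eq ?_)
    field_simp
  refine (Finset.sum_le_sum fun u _ => hterm u).trans (le_of_eq ?_)
  have hone : ∑ u : Fin k → Fin m, μ.real (cyl u) = 1 := by
    have := integral_comp_pre μ (n := k) fun _ => (1 : ℝ)
    simpa using this.symm
  rw [Finset.sum_add_distrib, ← Finset.mul_sum, hone, Finset.sum_const, Finset.card_univ,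
    Fintype.card_fun, Fintype.card_fin, Fintype.card_fin, nsmul_eq_mul]
  push_cast
  field_simp

theorem abs_integral_logMass_le (μ : Measure (SeqSpace m)) [IsProbabilityMeasure μ] (k : ℕ) :
    |∫ x, logMass μ x k ∂μ| ≤ 1 + ∫ x, logMass μ x k ^ 2 ∂μ := by
  have h1 : Integrable (fun x => logMass μ x k) μ :=
    memLp_one_iff_integrable.1 (memLp_logMass μ k 1)
  have h2 : Integrable (fun x => logMass μ x k ^ 2) μ := (memLp_logMass μ k 2).integrable_sq
  have h3 : ∫ x, (1 + logMass μ x k ^ 2) ∂μ = 1 + ∫ x, logMass μ x k ^ 2 ∂μ := by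
    rw [integral_add (integrable_const _) h2]; simp
  rw [← h3]
  refine abs_integral_le_integral_abs.trans (integral_mono h1.abs ((integrable_const _).add h2)
    fun x => ?_)
  show |logMass μ x k| ≤ 1 + logMass μ x k ^ 2
  nlinarith [sq_abs (logMass μ x k), abs_nonneg (logMass μ x k),
    sq_nonneg (|logMass μ x k| - 1)]

/-! ### A law of large numbers -/

open ProbabilityTheory in
-- The expectation of `∑ (W_j - E W_j)²` is `∑ Var W_j < ∞`, so almost surely the series converges
-- and its terms tend to `0`. No independence between different `j` is needed.
theorem ae_tendsto_of_summable_variance {Ω : Type*} [MeasurableSpace Ω] {ν : Measure Ω}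
    [IsProbabilityMeasure ν] {W : ℕ → Ω → ℝ} (hW : ∀ j, MemLp (W j) 2 ν)
    (hvar : Summable fun j => Var[W j; ν]) {s : ℝ}
    (hmean : Tendsto (fun j => ∫ ω, W j ω ∂ν) atTop (𝓝 s)) :
    ∀ᵐ ω ∂ν, Tendsto (fun j => W j ω) atTop (𝓝 s) := by
  have hmeas : ∀ j, AEMeasurable
      (fun ω => ENNReal.ofReal ((W j ω - ∫ x, W j x ∂ν) ^ 2)) ν := fun j =>
    (((hW j).1.aemeasurable.sub_const _).pow_const 2).ennreal_ofReal
  have hfin : ∫⁻ ω, ∑' j, ENNReal.ofReal ((W j ω - ∫ x, W j x ∂ν) ^ 2) ∂ν ≠ ⊤ := by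
    rw [lintegral_tsum hmeas]
    simp_rw [← evariance_eq_lintegral_ofReal, ← (hW _).ofReal_variance_eq]
    rw [← ENNReal.ofReal_tsum_of_nonneg (fun j => variance_nonneg _ _) hvar]
    exact ENNReal.ofReal_ne_top
  filter_upwards [ae_lt_top' (AEMeasurable.tsum hmeas) hfin] with ω hω
  have h1 := ENNReal.tendsto_atTop_zero_of_tsum_ne_top hω.ne
  have h2 : Tendsto (fun j => (W j ω - ∫ x, W j x ∂ν) ^ 2) atTop (𝓝 0) := by
    have := (ENNReal.tendsto_toReal ENNReal.zero_ne_top).comp h1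
    refine this.congr fun j => ?_
    simp only [Function.comp]
    exact ENNReal.toReal_ofReal (sq_nonneg _)
  have h3 : Tendsto (fun j => W j ω - ∫ x, W j x ∂ν) atTop (𝓝 0) := by
    have := h2.sqrt
    rw [Real.sqrt_zero] at this
    simp_rw [Real.sqrt_sq_eq_abs] at this
    exact tendsto_zero_iff_abs_tendsto_zero _ |>.2 this
  simpa using h3.add hmean

/-- Consecutive squares have ratio tending to `1`, so a monotone sequence is squeezed between its
values at squares. -/
theorem tendsto_div_of_monotone_of_tendsto_sq {u : ℕ → ℝ} (hu : Monotone u) {s : ℝ}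
    (h : Tendsto (fun j : ℕ => ((j : ℝ) ^ 2)⁻¹ * u (j ^ 2)) atTop (𝓝 s)) :
    Tendsto (fun n : ℕ => u n / n) atTop (𝓝 s) := by
  refine tendsto_div_of_monotone_of_exists_subseq_tendsto_div u s hu fun a ha =>
    ⟨fun j => j ^ 2, ?_, tendsto_pow_atTop two_ne_zero, h.congr fun j => ?_⟩
  · have h1 : Tendsto (fun n : ℕ => (1 + 1 / (n : ℝ)) ^ 2) atTop (𝓝 1) := by
      have := (tendsto_one_div_atTop_nhds_zero_nat (𝕜 := ℝ)).const_add 1 |>.pow 2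
      simpa using this
    filter_upwards [h1.eventually_lt_const ha, eventually_gt_atTop 0] with n hn hn0
    have hn0' : (0 : ℝ) < n := by exact_mod_cast hn0
    push_cast
    have h2 : ((n : ℝ) + 1) ^ 2 = (1 + 1 / (n : ℝ)) ^ 2 * (n : ℝ) ^ 2 := by
      field_simp
    rw [h2]
    gcongr
  · push_cast
    rw [div_eq_inv_mul]

/-! ### The measure `ℙ_μ` -/

theorem along_weave {q : ℕ} (hq : 2 ≤ q) {i : ℕ} (hi0 : 0 < i) (hi : ¬ q ∣ i)
    (ω : ℕ → SeqSpace m) : along q i (weave q ω) = ω i := by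
  funext l
  have hpos : 0 < i * q ^ l := by positivity
  have h : i * q ^ l - 1 + 1 = i * q ^ l := by omega
  rw [along, weave, h, multiplicity_mul_pow hq hi,
    Nat.mul_div_cancel _ (by positivity : 0 < q ^ l)]

theorem logMass_mulMeasure_weave {q : ℕ} (hq : 2 ≤ q) (μ : Measure (SeqSpace m))
    [IsProbabilityMeasure μ] (ω : ℕ → SeqSpace m) {n : ℕ}
    (hpos : mulMeasure q μ (cyl (pre (weave q ω) n)) ≠ 0) :
    logMass (mulMeasure q μ) (weave q ω) n
      = ∑ i ∈ progHeads q n, logMass μ (ω i) (Nat.log q (n / i) + 1) := by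
  have h : mulMeasure q μ (cyl (pre (weave q ω) n))
      = ∏ i ∈ progHeads q n, μ (cyl (pre (ω i) (Nat.log q (n / i) + 1))) := by
    rw [mulMeasure_cyl hq, progHeads]
    refine Finset.prod_congr rfl fun i hi => ?_
    obtain ⟨⟨h1, -⟩, h3⟩ := mem_progHeads.1 hi
    rw [along_weave hq h1 h3]
  rw [h, Finset.prod_ne_zero_iff] at hpos
  -- Positivity of the product makes every factor nonzero, as the logarithm of a product requires.
  simp only [logMass]
  rw [measureReal_def, h, ENNReal.toReal_prod, Real.logb_prod, Finset.sum_neg_distrib]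
  · rfl
  · exact fun i hi => (ENNReal.toReal_pos (hpos i hi) (measure_ne_top _ _)).ne'

theorem ae_mulMeasure_mem_mulSubshift {q : ℕ} (hq : 2 ≤ q) {Ω : Set (SeqSpace m)}
    (hΩ : MeasurableSet Ω) {μ : Measure (SeqSpace m)} [IsProbabilityMeasure μ]
    (hμ : ∀ᵐ x ∂μ, x ∈ Ω) : ∀ᵐ x ∂(mulMeasure q μ), x ∈ mulSubshift q Ω := by
  have hmeas : MeasurableSet (mulSubshift q Ω) := by
    have : mulSubshift q Ω = ⋂ i : ℕ, ⋂ _ : 0 < i, ⋂ _ : ¬ q ∣ i, along q i ⁻¹' Ω := by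
      ext x; simp [mulSubshift]
    rw [this]
    refine .iInter fun i => .iInter fun _ => .iInter fun _ => ?_
    have : Measurable (along (m := m) q i) := measurable_pi_lambda (X := fun _ : ℕ => Fin m) _
      fun l => measurable_pi_apply (X := fun _ : ℕ => Fin m) (i * q ^ l - 1)
    exact this hΩ
  refine (ae_map_iff (measurable_weave q).aemeasurable hmeas).2 ?_
  have h : ∀ᵐ ω ∂(Measure.infinitePi fun _ : ℕ => μ), ∀ i, ω i ∈ Ω := ae_all_iff.2 fun i =>
    (measurePreserving_eval_infinitePi (fun _ : ℕ => μ) i).quasiMeasurePreserving.ae hμ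
  filter_upwards [h] with ω hω i hi0 hi
  rw [along_weave hq hi0 hi]
  exact hω i

/-- Both the mean of the information function and its second moment grow at most quadratically. -/
theorem exists_moment_bound (hm : 2 ≤ m) (μ : Measure (SeqSpace m)) [IsProbabilityMeasure μ] :
    ∃ C : ℝ, ∀ k : ℕ, |∫ x, logMass μ x (k + 1) ^ 2 ∂μ| ≤ C * ((k : ℝ) + 1) ^ 2 ∧
      |∫ x, logMass μ x (k + 1) ∂μ| ≤ C * ((k : ℝ) + 1) ^ 2 := by
  refine ⟨5 + 16 / Real.log m ^ 2, fun k => ?_⟩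
  have h1 := integral_logMass_sq_le hm μ (k + 1)
  have h2 := abs_integral_logMass_le μ (k + 1)
  have h3 : 0 ≤ ∫ x, logMass μ x (k + 1) ^ 2 ∂μ := integral_nonneg fun x => sq_nonneg _
  have h4 : (1 : ℝ) ≤ ((k : ℝ) + 1) ^ 2 := one_le_pow₀ (by linarith [Nat.cast_nonneg (α := ℝ) k])
  have h5 : 0 ≤ 16 / Real.log m ^ 2 := by positivity
  push_cast at h1
  rw [abs_of_nonneg h3]
  constructor <;> nlinarith

open ProbabilityTheory in
/-- The law of large numbers for `-log_m ℙ_μ[x_1 … x_n]` along the squares. -/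
theorem ae_tendsto_sum_logMass_sq (hm : 2 ≤ m) {q : ℕ} (hq : 2 ≤ q) {Ω : Set (SeqSpace m)}
    {μ : Measure (SeqSpace m)} [IsProbabilityMeasure μ] (hμ : ∀ᵐ x ∂μ, x ∈ Ω) :
    ∀ᵐ ω ∂(Measure.infinitePi fun _ : ℕ => μ), Tendsto (fun j : ℕ => ((j : ℝ) ^ 2)⁻¹ *
      ∑ i ∈ progHeads q (j ^ 2), logMass μ (ω i) (Nat.log q (j ^ 2 / i) + 1)) atTop
      (𝓝 (sDim q Ω μ)) := by
  set ν : Measure (ℕ → SeqSpace m) := Measure.infinitePi fun _ : ℕ => μ with hν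
  obtain ⟨C, hC⟩ := exists_moment_bound hm μ
  have hsq : Tendsto (fun j : ℕ => j ^ 2) atTop atTop := tendsto_pow_atTop two_ne_zero
  have hpres : ∀ i, MeasurePreserving (Function.eval i) ν μ :=
    measurePreserving_eval_infinitePi fun _ : ℕ => μ
  -- This is a triangular array: the word length used for `ω i` grows with `n`. Independence is used
  -- only within a row.
  let X : ℕ → ℕ → (ℕ → SeqSpace m) → ℝ := fun n i ω => logMass μ (ω i) (Nat.log q (n / i) + 1)
  have hX : ∀ n i, MemLp (X n i) 2 ν := fun n i =>
    (memLp_logMass μ (Nat.log q (n / i) + 1) 2).comp_measurePreserving (hpres i)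
  have hZ : ∀ n, MemLp (∑ i ∈ progHeads q n, X n i) 2 ν := fun n =>
    memLp_finsetSum' _ fun i _ => hX n i
  have hmeanX : ∀ n i, ∫ ω, X n i ω ∂ν = entropy Ω μ (Nat.log q (n / i) + 1) := by
    intro n i
    have h := integral_map (μ := ν) (hpres i).measurable.aemeasurable
      (measurable_logMass μ (Nat.log q (n / i) + 1)).aestronglyMeasurable
    rw [(hpres i).map_eq, integral_logMass hμ] at h
    exact h.symm
  have hmean : ∀ n, ∫ ω, (∑ i ∈ progHeads q n, X n i) ω ∂ν
      = ∑ i ∈ progHeads q n, entropy Ω μ (Nat.log q (n / i) + 1) := by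
    intro n
    simp_rw [Finset.sum_apply]
    rw [integral_finsetSum _ fun i _ => (hX n i).integrable one_le_two]
    exact Finset.sum_congr rfl fun i _ => hmeanX n i
  have hvar : ∀ n, Var[∑ i ∈ progHeads q n, X n i; ν]
      ≤ ∑ i ∈ progHeads q n, ∫ x, logMass μ x (Nat.log q (n / i) + 1) ^ 2 ∂μ := by
    intro n
    have hind : iIndepFun (X n) ν := iIndepFun_infinitePi
      (X := fun i (x : SeqSpace m) => logMass μ x (Nat.log q (n / i) + 1))
      fun i => measurable_logMass μ _
    rw [IndepFun.variance_sum (fun i _ => hX n i) fun i _ j _ hij => hind.indepFun hij]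
    refine Finset.sum_le_sum fun i _ => ?_
    have h := (hpres i).variance_fun_comp
      (measurable_logMass μ (Nat.log q (n / i) + 1)).aemeasurable
    exact h.le.trans
      (variance_le_expectation_sq (measurable_logMass μ _).aestronglyMeasurable)
  -- The averaging lemma is used twice: for second moments, to bound the variance of row `n` by `M
  -- n`, and for entropies, to find the limit of the means.
  obtain ⟨-, hlimV⟩ := tendsto_sum_progHeads_div hq
    (h := fun k => ∫ x, logMass μ x k ^ 2 ∂μ) (C := C) fun k => (hC k).1
  obtain ⟨-, hlimE⟩ := tendsto_sum_progHeads_div hq (h := entropy Ω μ) (C := C)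
    fun k => by rw [← integral_logMass hμ]; exact (hC k).2
  obtain ⟨M, hM⟩ := hlimV.bddAbove_range
  have hM' : ∀ j : ℕ, Var[((j : ℝ) ^ 2)⁻¹ • ∑ i ∈ progHeads q (j ^ 2), X (j ^ 2) i; ν]
      ≤ M * (1 / (j : ℝ) ^ 2) := by
    intro j
    rw [variance_smul]
    have h1 := hM ⟨j ^ 2, rfl⟩
    rcases Nat.eq_zero_or_pos j with rfl | hj
    · simp
    have hj' : (0 : ℝ) < (j : ℝ) ^ 2 := by positivity
    push_cast at h1
    have h2 := (hvar (j ^ 2)).trans ((div_le_iff₀ hj').1 h1)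
    calc (((j : ℝ) ^ 2)⁻¹) ^ 2 * Var[∑ i ∈ progHeads q (j ^ 2), X (j ^ 2) i; ν]
        ≤ (((j : ℝ) ^ 2)⁻¹) ^ 2 * (M * (j : ℝ) ^ 2) := by gcongr
      _ = M * (1 / (j : ℝ) ^ 2) := by field_simp
  have hsum : Summable fun j : ℕ =>
      Var[((j : ℝ) ^ 2)⁻¹ • ∑ i ∈ progHeads q (j ^ 2), X (j ^ 2) i; ν] :=
    Summable.of_nonneg_of_le (fun j => variance_nonneg _ _) hM'
      ((Real.summable_one_div_nat_pow.2 one_lt_two).mul_left M)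
  have key := ae_tendsto_of_summable_variance
    (W := fun j : ℕ => ((j : ℝ) ^ 2)⁻¹ • ∑ i ∈ progHeads q (j ^ 2), X (j ^ 2) i)
    (fun j => (hZ _).const_smul _) hsum (s := sDim q Ω μ) (by
      refine (hlimE.comp hsq).congr fun j => ?_
      simp only [Function.comp, Pi.smul_apply, smul_eq_mul]
      rw [integral_const_mul, hmean]
      push_cast
      rw [div_eq_inv_mul])
  filter_upwards [key] with ω hω
  refine hω.congr fun j => ?_
  simp only [Pi.smul_apply, Finset.sum_apply, smul_eq_mul, X]

theorem ae_tendsto_logMass_mulMeasure (hm : 2 ≤ m) {q : ℕ} (hq : 2 ≤ q) {Ω : Set (SeqSpace m)}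
    {μ : Measure (SeqSpace m)} [IsProbabilityMeasure μ] (hμ : ∀ᵐ x ∂μ, x ∈ Ω) :
    ∀ᵐ x ∂(mulMeasure q μ), (∀ n, mulMeasure q μ (cyl (pre x n)) ≠ 0) ∧
      Tendsto (fun n => logMass (mulMeasure q μ) x n / n) atTop (𝓝 (sDim q Ω μ)) := by
  have hpos := ae_measure_cyl_ne_zero (mulMeasure q μ)
  have hpos' := ae_of_ae_map (measurable_weave q).aemeasurable hpos
  refine hpos.and ?_
  -- The convergence set is measurable, so the claim can be checked on the independent sequences
  -- `ω`.
  refine (ae_map_iff (measurable_weave q).aemeasurable (measurableSet_tendsto _ fun n =>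
    (measurable_logMass _ n).div_const _)).2 ?_
  filter_upwards [hpos', ae_tendsto_sum_logMass_sq hm hq hμ] with ω h1 h2
  refine tendsto_div_of_monotone_of_tendsto_sq (logMass_monotone hm h1) (h2.congr fun j => ?_)
  rw [logMass_mulMeasure_weave hq μ ω (h1 _)]

theorem summable_sTerm (hm : 2 ≤ m) {q : ℕ} (hq : 2 ≤ q) {Ω : Set (SeqSpace m)}
    {μ : Measure (SeqSpace m)} [IsProbabilityMeasure μ] (hμ : ∀ᵐ x ∂μ, x ∈ Ω) :
    Summable (sTerm q Ω μ) := by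
  obtain ⟨C, hC⟩ := exists_moment_bound hm μ
  exact (tendsto_sum_progHeads_div hq (h := entropy Ω μ) (C := C)
    fun k => by rw [← integral_logMass hμ]; exact (hC k).2).1

end MulFractal

theorem proposition2p3 (m q : ℕ) (hm : 2 ≤ m) (hq : 2 ≤ q)
    (Ω : Set (MulFractal.SeqSpace m)) (hΩ : IsClosed Ω)
    (μ : Measure (MulFractal.SeqSpace m)) [IsProbabilityMeasure μ] (hμ : μ Ω = 1) :
    Summable (MulFractal.sTerm q Ω μ) ∧
    (∀ᵐ x ∂(MulFractal.mulMeasure q μ), x ∈ MulFractal.mulSubshift q Ω ∧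
      MulFractal.HasLocalDim (MulFractal.mulMeasure q μ) x (MulFractal.sDim q Ω μ)) ∧
    MulFractal.dimHMeasure (MulFractal.mulMeasure q μ)
      = ENNReal.ofReal (MulFractal.sDim q Ω μ) ∧
    ENNReal.ofReal (MulFractal.sDim q Ω μ) ≤ dimH (MulFractal.mulSubshift q Ω) := by
  have hae : ∀ᵐ x ∂μ, x ∈ Ω :=
    (mem_ae_iff_prob_eq_one (μ := μ) hΩ.measurableSet).2 hμ
  have hmem := MulFractal.ae_mulMeasure_mem_mulSubshift hq hΩ.measurableSet hae
  have hlim := MulFractal.ae_tendsto_logMass_mulMeasure hm hq hae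
  have hloc : ∀ᵐ x ∂(MulFractal.mulMeasure q μ),
      MulFractal.HasLocalDim (MulFractal.mulMeasure q μ) x (MulFractal.sDim q Ω μ) :=
    hlim.mono fun x hx => MulFractal.hasLocalDim_of_tendsto_logMass hm hx.1 hx.2
  refine ⟨MulFractal.summable_sTerm hm hq hae, hmem.and hloc, le_antisymm ?_ ?_, ?_⟩
  -- The infimum runs over Borel sets, so a Borel set of full measure is chosen inside the set of
  -- good points.
  · obtain ⟨G, hGae, hG, hGsub⟩ := hlim.exists_measurable_mem
    have hG1 := (mem_ae_iff_prob_eq_one (μ := MulFractal.mulMeasure q μ) hG).1 hGae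
    exact (iInf₂_le G hG).trans ((iInf_le _ hG1).trans
      (MulFractal.dimH_le_of_tendsto_logMass hm (fun x hx => (hGsub x hx).1)
        fun x hx => (hGsub x hx).2))
  · refine le_iInf fun F => le_iInf fun _ => le_iInf fun hF => ?_
    exact MulFractal.le_dimH_of_ae_hasLocalDim hloc (by rw [hF]; exact one_ne_zero)
  · refine MulFractal.le_dimH_of_ae_hasLocalDim hloc fun h0 => ?_
    obtain ⟨x, hx, hx'⟩ := (hmem.and (measure_eq_zero_iff_ae_notMem.1 h0)).exists
    exact hx' hx
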